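/- All graphs are finite, undirected and simple, and the eigenvalues of a graph are those of its adjacency matrix. A Terwilliger graph is a connected non-complete graph $\Gamma$ such that, for some fixed integer $\mu \ge 1$, for any two vertices $u, v$ at distance two the set of common neighbours of $u$ and $v$ is a clique of size $\mu$. A $k$-regular graph is strongly regular if there are constants $a$ and $c$ such that any two adjacent vertices have exactly $a$ common neighbours and any two distinct non-adjacent vertices have exactly $c$ common neighbours. Let $m \ge 2$ be an integer. Then there are, up to isomorphism, only finitely many non-complete strongly regular Terwilliger graphs with smallest eigenvalue at least $-m$. -/

import Mathlib

/-- A Terwilliger graph: a connected non-complete graph such that, for any two vertices `u`, `v`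
at distance two, the common neighbours of `u` and `v` form a clique of size `μ`, for some fixed
`μ ≥ 1`. -/
def SimpleGraph.IsTerwilliger {V : Type*} (G : SimpleGraph V) : Prop :=
  G.Connected ∧ G ≠ ⊤ ∧
    ∃ μ : ℕ, 1 ≤ μ ∧ ∀ u v : V, G.dist u v = 2 →
      G.IsClique (G.commonNeighbors u v) ∧ (G.commonNeighbors u v).ncard = μ

/-- A graph is strongly regular if it is strongly regular with some parameters. -/
def SimpleGraph.IsStronglyRegular {V : Type*} [Fintype V] [DecidableEq V] (G : SimpleGraph V)
    [DecidableRel G.Adj] : Prop :=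
  ∃ n k a c : ℕ, G.IsSRGWith n k a c

/-- `θ` is the smallest eigenvalue of the graph `G`, that is, of its real adjacency matrix. -/
def SimpleGraph.IsSmallestEigenvalue {V : Type*} [Fintype V] [DecidableEq V] (G : SimpleGraph V)
    [DecidableRel G.Adj] (θ : ℝ) : Prop :=
  IsLeast {η : ℝ | Module.End.HasEigenvalue (Matrix.toLin' (G.adjMatrix ℝ)) η} θ

/-! ### Positive semidefiniteness and forbidden configurations. -/

namespace SimpleGraph

open Finset

variable {V : Type*} {G : SimpleGraph V} [DecidableRel G.Adj]

/-! The eigenvalue bound says that A + mI is positive semidefinite. Test vectors then give two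
prohibitions: no neighbourhood contains an independent set of more than m² vertices
(`FormBound.card_claw_le`), and if u is joined to all of P and none of W while P and W are
completely joined, then P or W has at most 2m² vertices (`FormBound.card_joined_le`). Connectedness
gives c ≥ 1, hence |V| ≤ 1 + k + k², so it suffices to bound k.

Suppose c is large. Fix u and attach to each non-neighbour v the c-clique of common neighbours of u
and v. Two such cliques nearly coincide or are nearly disjoint; each nearly coincides with at most
2m² others or itself, and m² + 1 nearly disjoint ones would contain a forbidden independent
transversal. So every vertex has at most some N non-neighbours; each neighbour of u shares a
non-neighbour with u, whence k ≤ N².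

Suppose c is bounded. Then k ≤ m²(a + 1), so it suffices to bound a. If a is huge, a neighbourhood
splits into s ≤ m² cliques, and k = s(a + 1) - B with B ≤ s²c. As c ≤ a, (a - c)² + 4(k - c) is a
perfect square; it is so near (a - c + 2s)² that they agree, which forces B = (s - 1)(c - s). Double
counting common neighbours of non-adjacent pairs inside the neighbourhood contradicts this value of
B. -/

/-- The number of ordered adjacent pairs between `S` and `T`. -/
def edgeSum (G : SimpleGraph V) [DecidableRel G.Adj] (S T : Finset V) : ℝ :=
  ∑ v ∈ S, ∑ w ∈ T, if G.Adj v w then 1 else 0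

theorem edgeSum_comm (S T : Finset V) : G.edgeSum S T = G.edgeSum T S := by
  unfold edgeSum
  rw [Finset.sum_comm]
  simp only [G.adj_comm]

theorem edgeSum_le (S T : Finset V) : G.edgeSum S T ≤ #S * #T := by
  unfold edgeSum
  calc _ ≤ ∑ v ∈ S, ∑ w ∈ T, (1 : ℝ) := by
        gcongr
        split_ifs <;> norm_num
    _ = _ := by simp

theorem edgeSum_complete {S T : Finset V} (h : ∀ v ∈ S, ∀ w ∈ T, G.Adj v w) :
    G.edgeSum S T = #S * #T := by
  unfold edgeSum
  calc _ = ∑ v ∈ S, ∑ w ∈ T, (1 : ℝ) :=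
        Finset.sum_congr rfl fun v hv => Finset.sum_congr rfl fun w hw => if_pos (h v hv w hw)
    _ = _ := by simp

theorem edgeSum_empty {S T : Finset V} (h : ∀ v ∈ S, ∀ w ∈ T, ¬ G.Adj v w) :
    G.edgeSum S T = 0 :=
  Finset.sum_eq_zero fun v hv => Finset.sum_eq_zero fun w hw => if_neg (h v hv w hw)

theorem sum_sum_const {S T : Finset V} {f : V → ℝ} {x y : ℝ} (hS : ∀ v ∈ S, f v = x)
    (hT : ∀ w ∈ T, f w = y) :
    ∑ v ∈ S, ∑ w ∈ T, (if G.Adj v w then f v * f w else 0) = x * y * G.edgeSum S T := by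
  unfold edgeSum
  simp only [Finset.mul_sum]
  refine Finset.sum_congr rfl fun v hv => Finset.sum_congr rfl fun w hw => ?_
  rw [hS v hv, hT w hw]
  split_ifs <;> simp

variable [Fintype V] [DecidableEq V]

/-- The adjacency form of `G` is bounded below by `-m`. -/
def FormBound (G : SimpleGraph V) [DecidableRel G.Adj] (m : ℕ) : Prop :=
  ∀ f : V → ℝ, 0 ≤ m * ∑ v, f v ^ 2 + ∑ v, ∑ w, if G.Adj v w then f v * f w else 0

theorem IsSmallestEigenvalue.formBound {θ : ℝ} (h : G.IsSmallestEigenvalue θ) {m : ℕ}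
    (hm : -(m : ℝ) ≤ θ) : G.FormBound m := by
  have hA : (G.adjMatrix ℝ).IsHermitian := by
    rw [Matrix.IsHermitian, Matrix.conjTranspose_eq_transpose_of_trivial]
    exact isSymm_adjMatrix G
  have hB : (G.adjMatrix ℝ + (m : ℝ) • (1 : Matrix V V ℝ)).IsHermitian := by
    refine hA.add ?_
    rw [Matrix.IsHermitian, Matrix.conjTranspose_eq_transpose_of_trivial]
    simp
  have hpos : (G.adjMatrix ℝ + (m : ℝ) • (1 : Matrix V V ℝ)).PosSemidef := by
    rw [hB.posSemidef_iff_eigenvalues_nonneg]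
    intro i
    have h1 := hB.mulVec_eigenvectorBasis i
    have hne : (hB.eigenvectorBasis i : EuclideanSpace ℝ V).ofLp ≠ 0 := by
      intro h0
      apply hB.eigenvectorBasis.orthonormal.ne_zero i
      ext j
      exact congrFun h0 j
    have hev : Module.End.HasEigenvalue (Matrix.toLin' (G.adjMatrix ℝ)) (hB.eigenvalues i - m) := by
      apply Module.End.hasEigenvalue_of_hasEigenvector
        (x := (hB.eigenvectorBasis i : EuclideanSpace ℝ V).ofLp)
      refine ⟨?_, hne⟩
      rw [Module.End.mem_eigenspace_iff, Matrix.toLin'_apply, sub_smul, ← h1, Matrix.add_mulVec,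
        Matrix.smul_mulVec, Matrix.one_mulVec, add_sub_cancel_right]
    have := h.2 hev
    simp only [Pi.zero_apply]
    linarith
  intro f
  have h2 := hpos.dotProduct_mulVec_nonneg f
  rw [Matrix.add_mulVec, Matrix.smul_mulVec, Matrix.one_mulVec, dotProduct_add] at h2
  have e1 : star f ⬝ᵥ (m : ℝ) • f = m * ∑ v, f v ^ 2 := by
    simp only [dotProduct, Finset.mul_sum, Pi.smul_apply, smul_eq_mul, star_trivial]
    exact Finset.sum_congr rfl fun v _ => by ring
  have e2 : star f ⬝ᵥ (G.adjMatrix ℝ).mulVec f =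
      ∑ v, ∑ w, if G.Adj v w then f v * f w else 0 := by
    simp only [dotProduct, Matrix.mulVec, Finset.mul_sum, star_trivial, adjMatrix_apply]
    exact Finset.sum_congr rfl fun v _ => Finset.sum_congr rfl fun w _ => by split_ifs <;> ring
  linarith

theorem FormBound.restrict {m : ℕ} (h : G.FormBound m) (S : Finset V) (f : V → ℝ) :
    0 ≤ m * ∑ v ∈ S, f v ^ 2 + ∑ v ∈ S, ∑ w ∈ S, if G.Adj v w then f v * f w else 0 := by
  have := h fun v => if v ∈ S then f v else 0
  convert this using 2
  · congr 1
    rw [← Finset.sum_subset (Finset.subset_univ S) fun v _ hv => by simp [hv]]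
    exact Finset.sum_congr rfl fun v hv => by simp [hv]
  · rw [← Finset.sum_subset (Finset.subset_univ S)]
    · refine Finset.sum_congr rfl fun v hv => ?_
      rw [← Finset.sum_subset (Finset.subset_univ S)]
      · refine Finset.sum_congr rfl fun w hw => ?_
        simp [hv, hw]
      · intro w _ hw
        simp [hw]
    · intro v _ hv
      simp [hv]

/-- The quadratic form at a vector constant on three blocks; both prohibitions below are instances.
-/
theorem FormBound.three_part {m : ℕ} (h : G.FormBound m) {S P W : Finset V}
    (hSP : Disjoint S P) (hSW : Disjoint S W) (hPW : Disjoint P W) (x y z : ℝ) :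
    0 ≤ m * (#S * x ^ 2 + #P * y ^ 2 + #W * z ^ 2) + x ^ 2 * G.edgeSum S S +
      y ^ 2 * G.edgeSum P P + z ^ 2 * G.edgeSum W W + 2 * x * y * G.edgeSum S P +
      2 * x * z * G.edgeSum S W + 2 * y * z * G.edgeSum P W := by
  set f : V → ℝ := fun v => if v ∈ S then x else if v ∈ P then y else z with hf
  have fS : ∀ v ∈ S, f v = x := fun v hv => if_pos hv
  have fP : ∀ v ∈ P, f v = y := fun v hv => by
    simp [hf, Finset.disjoint_right.mp hSP hv, hv]
  have fW : ∀ v ∈ W, f v = z := fun v hv => by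
    simp [hf, Finset.disjoint_right.mp hSW hv, Finset.disjoint_right.mp hPW hv]
  have hd : Disjoint S (P ∪ W) := Finset.disjoint_union_right.mpr ⟨hSP, hSW⟩
  have sq : ∀ {T : Finset V} {t : ℝ}, (∀ v ∈ T, f v = t) → ∑ v ∈ T, f v ^ 2 = #T * t ^ 2 := by
    intro T t ht
    rw [Finset.sum_congr rfl fun v hv => by rw [ht v hv]]
    simp
  have := h.restrict (S ∪ (P ∪ W)) f
  simp only [Finset.sum_union hd, Finset.sum_union hPW, Finset.sum_add_distrib, sq fS, sq fP, sq fW,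
    sum_sum_const fS fS, sum_sum_const fS fP, sum_sum_const fS fW, sum_sum_const fP fS,
    sum_sum_const fP fP, sum_sum_const fP fW, sum_sum_const fW fS, sum_sum_const fW fP,
    sum_sum_const fW fW, edgeSum_comm P S, edgeSum_comm W S, edgeSum_comm W P] at this
  linarith

theorem FormBound.card_claw_le {m : ℕ} (h : G.FormBound m) (hm : 0 < m) {u : V} {Y : Finset V}
    (hY : ∀ y ∈ Y, G.Adj u y) (hI : ∀ y ∈ Y, ∀ z ∈ Y, ¬ G.Adj y z) : #Y ≤ m ^ 2 := by
  have hu : Disjoint {u} Y := by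
    rw [Finset.disjoint_singleton_left]
    exact fun hu => G.loopless.irrefl u (hY u hu)
  -- With these weights the form equals m|Y|(m² - |Y|).
  have := h.three_part hu (Finset.disjoint_empty_right _) (Finset.disjoint_empty_right _)
    (-#Y : ℝ) m 0
  rw [edgeSum_empty hI, edgeSum_empty (S := {u}) (T := {u}) (by simp),
    edgeSum_complete (S := {u}) (by simpa using hY)] at this
  simp only [Finset.card_singleton] at this
  by_contra! hlt
  have h1 : (m : ℝ) ^ 2 < #Y := by exact_mod_cast hlt
  have h2 : (0 : ℝ) < m := by exact_mod_cast hm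
  have h3 : (0 : ℝ) < #Y := lt_of_le_of_lt (by positivity) h1
  have h4 : 0 < (m : ℝ) * (#Y * (#Y - m ^ 2)) :=
    mul_pos h2 (mul_pos h3 (by linarith))
  push_cast at this
  nlinarith

theorem FormBound.card_joined_le {m : ℕ} (h : G.FormBound m) (hm : 0 < m) {u : V}
    {P W : Finset V} (hP : ∀ p ∈ P, G.Adj u p) (hW : ∀ w ∈ W, ¬ G.Adj u w) (hu : u ∉ W)
    (hPW : ∀ p ∈ P, ∀ w ∈ W, G.Adj p w) : #P ≤ 2 * m ^ 2 ∨ #W ≤ 2 * m ^ 2 := by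
  by_contra! hcon
  obtain ⟨P', hP'P, hP'⟩ := Finset.exists_subset_card_eq (Nat.succ_le_of_lt hcon.1)
  obtain ⟨W', hW'W, hW'⟩ := Finset.exists_subset_card_eq (Nat.succ_le_of_lt hcon.2)
  have d1 : Disjoint {u} P' := by
    rw [Finset.disjoint_singleton_left]
    exact fun hu => G.loopless.irrefl u (hP u (hP'P hu))
  have d2 : Disjoint {u} W' := by
    rw [Finset.disjoint_singleton_left]
    exact fun h => hu (hW'W h)
  have d3 : Disjoint P' W' := by
    rw [Finset.disjoint_left]
    exact fun v h1 h2 => G.loopless.irrefl v (hPW v (hP'P h1) v (hW'W h2))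
  -- With n = 2m² + 1, the opposite signs on `P'` and `W'` let the join cancel all edges inside the
  -- two blocks, leaving at most mn(2m² - n) = -mn < 0.
  have := h.three_part d1 d2 d3 (-(2 * m ^ 2 + 1 : ℝ)) m (-m)
  rw [edgeSum_empty (S := {u}) (T := {u}) (by simp),
    edgeSum_complete (S := {u}) (T := P') (by simpa using fun p hp => hP p (hP'P hp)),
    edgeSum_empty (S := {u}) (T := W') (by simpa using fun p hp => hW p (hW'W hp)),
    edgeSum_complete (S := P') (T := W') fun p hp w hw => hPW p (hP'P hp) w (hW'W hw)] at this
  have e1 := G.edgeSum_le P' P'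
  have e2 := G.edgeSum_le W' W'
  rw [hP'] at *
  rw [hW'] at *
  push_cast [Finset.card_singleton] at *
  have h2 : (0 : ℝ) < m := by exact_mod_cast hm
  have f1 := mul_le_mul_of_nonneg_left e1 (sq_nonneg (m : ℝ))
  have f2 := mul_le_mul_of_nonneg_left e2 (sq_nonneg (m : ℝ))
  have h4 : 0 < (m : ℝ) * (2 * m ^ 2 + 1) := by positivity
  nlinarith

end SimpleGraph

/-! ### Integrality of the discriminant; strongly regular Terwilliger graphs. -/

namespace SimpleGraph

open Finset

/-- The trace of a projection is its rank. -/
theorem exists_nat_trace_eq {V : Type*} [Fintype V] [DecidableEq V] {E : Matrix V V ℝ}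
    (h : E * E = E) : ∃ f : ℕ, E.trace = f := by
  have hi : IsIdempotentElem (Matrix.toLin' E) := by
    rw [IsIdempotentElem, Module.End.mul_eq_comp, ← Matrix.toLin'_mul, h]
  have := ((LinearMap.isProj_range_iff_isIdempotentElem _).mpr hi).trace
  rw [Matrix.trace_toLin'_eq] at this
  exact ⟨_, this⟩

variable {V : Type*} [Fintype V] [DecidableEq V] {G : SimpleGraph V} [DecidableRel G.Adj]

theorem IsSRGWith.isSquare_discriminant {n k a c : ℕ} (h : G.IsSRGWith n k a c)
    (hn : 0 < n) (hk : 0 < k) (hca : c ≤ a) (hck : c ≤ k) (hkn : k + 1 ≤ n) (hak : a + 1 ≤ k) :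
    IsSquare ((a - c) ^ 2 + 4 * (k - c)) := by
  by_contra hsq
  have hirr := irrational_sqrt_natCast_iff.mpr hsq
  set D := (a - c) ^ 2 + 4 * (k - c) with hD
  set d : ℝ := √(D : ℝ) with hd
  have hdd : d ^ 2 = ((a : ℝ) - c) ^ 2 + 4 * (k - c) := by
    rw [hd, Real.sq_sqrt (by positivity), hD]
    push_cast [hca, hck]
    ring
  have hd0 : d ≠ 0 := fun h0 => hirr ⟨0, by simp [h0]⟩
  have hnR : (n : ℝ) ≠ 0 := by positivity
  -- The non-principal eigenvalues are roots of X² = (a - c)X + (k - c), with difference `d` and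
  -- smaller root `-t`. The choice of `κ` makes `N` kill the all-ones vector, so `N` is `d` times
  -- the projection onto the eigenspace of the larger root.
  set t : ℝ := (d - (a - c)) / 2 with ht
  set κ : ℝ := (k + t) / n with hκ
  set A := G.adjMatrix ℝ with hA
  set J : Matrix V V ℝ := Matrix.of fun _ _ => 1 with hJ
  have hpar : (k : ℝ) * (k - a - 1) = (n - k - 1) * c := by
    have := h.param_eq G hn
    rw [Nat.sub_sub, Nat.sub_sub] at this
    have := congrArg (Nat.cast (R := ℝ)) this
    push_cast [hkn, hak] at this
    linarith
  have hAA : A * A = ((k : ℝ) - c) • 1 + ((a : ℝ) - c) • A + (c : ℝ) • J := by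
    have h1 := h.matrix_eq (α := ℝ)
    have h2 : Gᶜ.adjMatrix ℝ = J - 1 - A := by
      ext v w
      by_cases hvw : v = w
      · simp [hA, hJ, hvw]
      · by_cases hadj : G.Adj v w <;> simp [hA, hJ, hvw, hadj]
    rw [pow_two, h2, ← Nat.cast_smul_eq_nsmul ℝ, ← Nat.cast_smul_eq_nsmul ℝ a,
      ← Nat.cast_smul_eq_nsmul ℝ c] at h1
    rw [h1]
    module
  have hAJ : A * J = (k : ℝ) • J := by
    ext v w
    have := adjMatrix_mulVec_const_apply_of_regular (α := ℝ) (a := 1) h.regular (v := v)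
    simpa [Matrix.mul_apply, Matrix.mulVec, dotProduct, hJ, hA] using this
  have hJA : J * A = (k : ℝ) • J := by
    have := congrArg Matrix.transpose hAJ
    rw [Matrix.transpose_mul, Matrix.transpose_smul, hA, transpose_adjMatrix] at this
    exact this
  have hJJ : J * J = (n : ℝ) • J := by
    ext v w
    simp [Matrix.mul_apply, hJ, h.card]
  set N : Matrix V V ℝ := A + t • 1 - κ • J with hN
  have ekn : κ * n = k + t := by rw [hκ]; field_simp
  have e1 : (k : ℝ) - c + t ^ 2 = d * t := by rw [ht]; linarith
  have e2 : (a : ℝ) - c + 2 * t = d := by rw [ht]; ring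
  have e3 : (c : ℝ) = κ * (k + t - d) := by
    have : (c : ℝ) * n = κ * n * (k + t - d) := by
      rw [ekn, ht]
      linarith
    exact mul_right_cancel₀ hnR (by linarith)
  have hNN : N * N = d • N := by
    have : N * N = A * A + (2 * t) • A + (t ^ 2) • 1 - κ • (A * J) - κ • (J * A)
        - (2 * t * κ) • J + (κ ^ 2) • (J * J) := by
      rw [hN]
      simp only [add_mul, mul_add, sub_mul, mul_sub, smul_mul_assoc, mul_smul_comm, one_mul,
        mul_one]
      module
    rw [this, hAA, hAJ, hJA, hJJ, hN]
    have e4 : (c : ℝ) - κ * k - κ * k - 2 * t * κ + κ ^ 2 * n = - d * κ := by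
      have : κ ^ 2 * n = κ * (k + t) := by rw [← ekn]; ring
      rw [this, e3]
      ring
    calc _ = ((k : ℝ) - c + t ^ 2) • (1 : Matrix V V ℝ) + ((a : ℝ) - c + 2 * t) • A +
          ((c : ℝ) - κ * k - κ * k - 2 * t * κ + κ ^ 2 * n) • J := by module
      _ = _ := by
        rw [e1, e2, e4]
        module
  obtain ⟨f, hf⟩ := exists_nat_trace_eq (E := d⁻¹ • N) (by
    rw [smul_mul_smul_comm, hNN, smul_smul]
    congr 1
    field_simp)
  have htr : N.trace = t * n - κ * n := by
    rw [hN, Matrix.trace_sub, Matrix.trace_add, Matrix.trace_smul, Matrix.trace_smul, hA,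
      trace_adjMatrix, Matrix.trace_one, h.card]
    simp [Matrix.trace, hJ, h.card]
  rw [Matrix.trace_smul, htr, ekn, smul_eq_mul, inv_mul_eq_iff_eq_mul₀ hd0] at hf
  have key : d * ((n : ℝ) - 1 - 2 * f) = (n - 1) * (a - c) + 2 * k := by
    rw [ht] at hf
    linarith
  have hkn' : (k : ℝ) + 1 ≤ n := by exact_mod_cast hkn
  have hca' : (c : ℝ) ≤ a := by exact_mod_cast hca
  have hk' : (0 : ℝ) < k := by exact_mod_cast hk
  -- This quantity vanishes for conference graphs, whose eigenvalues may be irrational; `c ≤ a`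
  -- excludes them.
  have hpos : 0 < ((n : ℝ) - 1) * (a - c) + 2 * k := by
    have := mul_nonneg (by linarith : (0 : ℝ) ≤ (n : ℝ) - 1) (sub_nonneg.mpr hca')
    linarith
  have hne : (n : ℝ) - 1 - 2 * f ≠ 0 := by
    intro h0
    rw [h0] at key
    linarith
  apply hirr
  refine ⟨((n - 1) * (a - c) + 2 * k) / (n - 1 - 2 * f), ?_⟩
  push_cast
  rw [← key, mul_div_cancel_right₀ _ hne]

/-- Strongly regular graphs with parameters `k, a, c` in which the common neighbours of two
vertices at distance two form a clique. -/
structure IsSRTerwilliger (G : SimpleGraph V) [DecidableRel G.Adj] (k a c : ℕ) : Prop where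
  srg : G.IsSRGWith (Fintype.card V) k a c
  regular : ∀ v, #(G.neighborFinset v) = k
  of_adj : ∀ {u v}, G.Adj u v → #(G.neighborFinset u ∩ G.neighborFinset v) = a
  of_not_adj : ∀ {u v}, u ≠ v → ¬ G.Adj u v → #(G.neighborFinset u ∩ G.neighborFinset v) = c
  clique : ∀ {u v}, u ≠ v → ¬ G.Adj u v → ∀ {p q}, G.Adj u p → G.Adj v p → G.Adj u q →
    G.Adj v q → p ≠ q → G.Adj p q
  pos : 1 ≤ c
  exists_not_adj : ∃ u v, u ≠ v ∧ ¬ G.Adj u v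

theorem neighborFinset_inter_eq (u v : V) :
    G.neighborFinset u ∩ G.neighborFinset v = (G.commonNeighbors u v).toFinset := by
  ext; simp [mem_commonNeighbors]

theorem IsTerwilliger.isSRTerwilliger (hT : G.IsTerwilliger) {n k a c : ℕ}
    (h : G.IsSRGWith n k a c) : G.IsSRTerwilliger k a c := by
  obtain ⟨hconn, htop, μ, -, hμ⟩ := hT
  have hna : ∀ {u v}, u ≠ v → ¬ G.Adj u v →
      #(G.neighborFinset u ∩ G.neighborFinset v) = c := by
    intro u v huv hadj
    rw [neighborFinset_inter_eq, Set.toFinset_card]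
    exact h.of_not_adj huv hadj
  have hex : ∃ u v, u ≠ v ∧ ¬ G.Adj u v := by
    by_contra! hcon
    exact htop (by ext u v; exact ⟨fun h => h.ne, fun h => hcon u v h⟩)
  have hpos : 1 ≤ c := by
    by_contra! hc
    obtain ⟨u, v, huv, hadj⟩ := hex
    -- If `c = 0`, being equal or adjacent is transitive, so a connected graph would be complete.
    have : ∀ w, G.Reachable u w → w = u ∨ G.Adj u w := by
      rintro w ⟨p⟩
      induction p using Walk.concatRec with
      | Hnil => exact Or.inl rfl
      | Hconcat p hvw ih =>
        rename_i x y z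
        by_contra! hcon
        have h0 := hna hcon.1.symm hcon.2
        rcases ih huv hadj with rfl | ih
        · exact hcon.2 hvw
        · have : y ∈ G.neighborFinset x ∩ G.neighborFinset z := by
            simp [ih, hvw.symm]
          have := Finset.card_pos.mpr ⟨_, this⟩
          omega
    rcases this v (hconn.preconnected u v) with h1 | h1
    · exact huv h1.symm
    · exact hadj h1
  refine ⟨h.card.symm ▸ h, fun v => by simpa using h.regular v, ?_, hna, ?_, hpos, hex⟩
  · intro u v hadj
    rw [neighborFinset_inter_eq, Set.toFinset_card]
    exact h.of_adj u v hadj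
  · intro u v huv hadj p q hup hvp huq hvq hpq
    have hd : G.dist u v = 2 := by
      have h2 : G.dist u v ≤ 2 := G.dist_le (Walk.cons hup (Walk.cons hvp.symm Walk.nil))
      have h0 : G.dist u v ≠ 0 := (hconn.dist_eq_zero_iff).not.mpr huv
      have h1 : G.dist u v ≠ 1 := (dist_eq_one_iff_adj).not.mpr hadj
      omega
    exact (hμ u v hd).1 ⟨hup, hvp⟩ ⟨huq, hvq⟩ hpq

end SimpleGraph

/-! ### Large `c`: few non-neighbours. -/

namespace SimpleGraph

open Finset

variable {V : Type*} {G : SimpleGraph V} [DecidableRel G.Adj] [DecidableEq V]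

/-- Sparse families of pairwise disjoint large sets have an independent transversal. -/
theorem exists_independent_transversal {ι : Type*} [DecidableEq ι] (T : Finset ι)
    (X : ι → Finset V) (M r : ℕ) (hr : #T ≤ r) (hX : ∀ i ∈ T, r * M < #(X i))
    (hd : ∀ i ∈ T, ∀ j ∈ T, i ≠ j → Disjoint (X i) (X j))
    (hM : ∀ i ∈ T, ∀ j ∈ T, i ≠ j → ∀ z ∈ X i, #{w ∈ X j | G.Adj z w} ≤ M) :
    ∃ Y ⊆ T.biUnion X, #Y = #T ∧ ∀ y ∈ Y, ∀ z ∈ Y, ¬ G.Adj y z := by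
  induction T using Finset.induction_on with
  | empty => exact ⟨∅, by simp⟩
  | insert i T hi ih =>
    rw [Finset.card_insert_of_notMem hi] at hr
    obtain ⟨Y, hYT, hYc, hYI⟩ := ih (by omega)
      (fun j hj => hX j (Finset.mem_insert_of_mem hj))
      (fun j hj l hl => hd j (Finset.mem_insert_of_mem hj) l (Finset.mem_insert_of_mem hl))
      (fun j hj l hl => hM j (Finset.mem_insert_of_mem hj) l (Finset.mem_insert_of_mem hl))
    have hii := Finset.mem_insert_self i T
    -- Greedy choice: fewer than `r` vertices are chosen so far and each excludes at most `M`
    -- vertices of `X i`.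
    have hbad : #(Y.biUnion fun y => {w ∈ X i | G.Adj y w}) ≤ #Y * M := by
      refine Finset.card_biUnion_le_card_mul _ _ _ fun y hy => ?_
      obtain ⟨j, hj, hyj⟩ := Finset.mem_biUnion.mp (hYT hy)
      exact hM j (Finset.mem_insert_of_mem hj) i hii (fun h => hi (h ▸ hj)) y hyj
    have hlt : #(Y.biUnion fun y => {w ∈ X i | G.Adj y w}) < #(X i) := by
      refine lt_of_le_of_lt hbad (lt_of_le_of_lt ?_ (hX i hii))
      exact Nat.mul_le_mul_right _ (by omega)
    obtain ⟨z, hz, hzn⟩ := Finset.exists_mem_notMem_of_card_lt_card hlt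
    have hzY : ∀ y ∈ Y, ¬ G.Adj y z := fun y hy hyz =>
      hzn (Finset.mem_biUnion.mpr ⟨y, hy, Finset.mem_filter.mpr ⟨hz, hyz⟩⟩)
    have hznot : z ∉ Y := by
      intro hzY'
      obtain ⟨j, hj, hzj⟩ := Finset.mem_biUnion.mp (hYT hzY')
      exact Finset.disjoint_left.mp
        (hd i hii j (Finset.mem_insert_of_mem hj) (fun h => hi (h ▸ hj))) hz hzj
    refine ⟨insert z Y, ?_, ?_, ?_⟩
    · rw [Finset.biUnion_insert]
      exact Finset.insert_subset (Finset.mem_union_left _ hz)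
        (hYT.trans Finset.subset_union_right)
    · rw [Finset.card_insert_of_notMem hznot, Finset.card_insert_of_notMem hi, hYc]
    · intro y hy w hw
      rcases Finset.mem_insert.mp hy with rfl | hy' <;>
        rcases Finset.mem_insert.mp hw with rfl | hw'
      · exact G.loopless.irrefl _
      · exact fun h => hzY w hw' h.symm
      · exact hzY y hy'
      · exact hYI y hy' w hw'

/-- A relation whose balls have at most `M` elements and whose separated sets have at most `r`
elements lives on a set of at most `r * M` elements. -/
theorem card_le_of_separated {α : Type*} [DecidableEq α] (S : Finset α) (close : α → α → Prop)
    [DecidableRel close] (hrefl : ∀ v ∈ S, close v v)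
    (hsymm : ∀ v ∈ S, ∀ w ∈ S, close v w → close w v) {M r : ℕ}
    (hM : ∀ v ∈ S, #{w ∈ S | close v w} ≤ M)
    (hr : ∀ R ⊆ S, (∀ v ∈ R, ∀ w ∈ R, v ≠ w → ¬ close v w) → #R ≤ r) : #S ≤ r * M := by
  obtain ⟨R, hR, hmax⟩ := Finset.exists_max_image
    (S.powerset.filter fun R => ∀ v ∈ R, ∀ w ∈ R, v ≠ w → ¬ close v w) Finset.card
    ⟨∅, by simp⟩
  rw [Finset.mem_filter, Finset.mem_powerset] at hR
  -- A separated set of maximum size is a net: the balls around it cover `S`.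
  have hcov : S ⊆ R.biUnion fun v => {w ∈ S | close v w} := by
    intro w hw
    by_contra hcon
    simp only [Finset.mem_biUnion, Finset.mem_filter, not_exists, not_and] at hcon
    have hwR : w ∉ R := fun h => hcon w h hw (hrefl w hw)
    have := hmax (insert w R) (by
      rw [Finset.mem_filter, Finset.mem_powerset]
      refine ⟨Finset.insert_subset hw hR.1, ?_⟩
      intro a ha b hb hab
      rcases Finset.mem_insert.mp ha with rfl | ha' <;>
        rcases Finset.mem_insert.mp hb with rfl | hb'
      · exact absurd rfl hab
      · exact fun h => hcon b hb' hw (hsymm _ hw _ (hR.1 hb') h)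
      · exact hcon a ha' hw
      · exact hR.2 a ha' b hb' hab)
    rw [Finset.card_insert_of_notMem hwR] at this
    omega
  calc #S ≤ #(R.biUnion fun v => {w ∈ S | close v w}) := Finset.card_le_card hcov
    _ ≤ #R * M := Finset.card_biUnion_le_card_mul _ _ _ fun v hv => hM v (hR.1 hv)
    _ ≤ r * M := Nat.mul_le_mul_right _ (hr R hR.1 hR.2)

variable [Fintype V]

/-- The common neighbours of two vertices. -/
def common (G : SimpleGraph V) [DecidableRel G.Adj] (u v : V) : Finset V :=
  G.neighborFinset u ∩ G.neighborFinset v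

theorem mem_common {u v w : V} : w ∈ G.common u v ↔ G.Adj u w ∧ G.Adj v w := by
  simp [common]

/-- The vertices different from and not adjacent to `u`. -/
def nonNeighbors (G : SimpleGraph V) [DecidableRel G.Adj] (u : V) : Finset V :=
  {v | v ≠ u ∧ ¬ G.Adj u v}

theorem mem_nonNeighbors {u v : V} : v ∈ G.nonNeighbors u ↔ v ≠ u ∧ ¬ G.Adj u v := by
  simp [nonNeighbors]

theorem nonNeighbors_symm {u v : V} (h : v ∈ G.nonNeighbors u) : u ∈ G.nonNeighbors v := by
  rw [mem_nonNeighbors] at *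
  exact ⟨h.1.symm, fun h' => h.2 h'.symm⟩

namespace IsSRTerwilliger

variable {k a c m : ℕ} (hG : G.IsSRTerwilliger k a c) (hF : G.FormBound m) (hm : 0 < m)

include hG

theorem card_common {u v : V} (h : v ∈ G.nonNeighbors u) : #(G.common u v) = c := by
  rw [mem_nonNeighbors] at h
  exact hG.of_not_adj h.1.symm h.2

theorem adj_of_mem_common {u v p q : V} (h : v ∈ G.nonNeighbors u) (hp : p ∈ G.common u v)
    (hq : q ∈ G.common u v) (hpq : p ≠ q) : G.Adj p q := by
  rw [mem_nonNeighbors] at h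
  rw [mem_common] at hp hq
  exact hG.clique h.1.symm h.2 hp.1 hp.2 hq.1 hq.2 hpq

include hF hm

/-- The vertex `w` sees all of the intersection and none of the difference, and these are completely
joined because both lie in the clique `G.common u v`. -/
theorem inter_or_sdiff_le {u v w : V} (hv : v ∈ G.nonNeighbors u) (hw : w ∈ G.nonNeighbors u) :
    #(G.common u v ∩ G.common u w) ≤ 2 * m ^ 2 ∨ #(G.common u v \ G.common u w) ≤ 2 * m ^ 2 := by
  rw [mem_nonNeighbors] at hw
  refine hF.card_joined_le hm (u := w) ?_ ?_ ?_ ?_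
  · intro p hp
    exact (mem_common.mp (Finset.mem_inter.mp hp).2).2
  · intro p hp hwp
    rw [Finset.mem_sdiff] at hp
    exact hp.2 (mem_common.mpr ⟨(mem_common.mp hp.1).1, hwp⟩)
  · intro h
    exact hw.2 (mem_common.mp (Finset.mem_sdiff.mp h).1).1
  · intro p hp q hq
    rw [Finset.mem_sdiff] at hq
    rw [Finset.mem_inter] at hp
    exact hG.adj_of_mem_common hv hp.1 hq.1 fun h => hq.2 (h ▸ hp.2)

/-- Together, 2m² + 1 close vertices miss at most (2m² + 1)2m² members of `G.common u v`. More than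
2m² members remain, joined to `u` and to all the close vertices, against `FormBound.card_joined_le`.
-/
theorem card_close_le {u v : V} (hv : v ∈ G.nonNeighbors u)
    (hc : (2 * m ^ 2 + 1) * (2 * m ^ 2) + 2 * m ^ 2 < c) :
    #{w ∈ G.nonNeighbors u | #(G.common u v \ G.common u w) ≤ 2 * m ^ 2} ≤ 2 * m ^ 2 := by
  by_contra! hcon
  obtain ⟨T, hT, hTc⟩ := Finset.exists_subset_card_eq (Nat.succ_le_of_lt hcon)
  have hT' : ∀ w ∈ T, w ∈ G.nonNeighbors u ∧ #(G.common u v \ G.common u w) ≤ 2 * m ^ 2 :=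
    fun w hw => Finset.mem_filter.mp (hT hw)
  have hbad : #(T.biUnion fun w => G.common u v \ G.common u w) ≤ #T * (2 * m ^ 2) :=
    Finset.card_biUnion_le_card_mul _ _ _ fun w hw => (hT' w hw).2
  have hcard := Finset.le_card_sdiff (T.biUnion fun w => G.common u v \ G.common u w)
    (G.common u v)
  rw [hG.card_common hv] at hcard
  rw [hTc] at hbad
  have := hF.card_joined_le hm (u := u)
    (P := G.common u v \ T.biUnion fun w => G.common u v \ G.common u w) (W := T)
    (fun p hp => (mem_common.mp (Finset.mem_sdiff.mp hp).1).1)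
    (fun w hw => (mem_nonNeighbors.mp (hT' w hw).1).2)
    (fun h => (mem_nonNeighbors.mp (hT' u h).1).1 rfl)
    (by
      intro p hp w hw
      rw [Finset.mem_sdiff, Finset.mem_biUnion] at hp
      by_contra hadj
      refine hp.2 ⟨w, hw, Finset.mem_sdiff.mpr ⟨hp.1, fun h => hadj ?_⟩⟩
      exact (mem_common.mp h).2.symm)
  simp only [Nat.succ_eq_add_one] at *
  omega

theorem card_separated_le {u : V} {R : Finset V} (hR : R ⊆ G.nonNeighbors u)
    (hsep : ∀ v ∈ R, ∀ w ∈ R, v ≠ w → ¬ #(G.common u v \ G.common u w) ≤ 2 * m ^ 2)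
    (hc : (2 * m ^ 2 + 1) * (2 * m ^ 2) + 2 * m ^ 2 < c)
    (hc' : (m ^ 2 + 1) * (6 * m ^ 2) < c) : #R ≤ m ^ 2 := by
  by_contra! hcon
  obtain ⟨T, hT, hTc⟩ := Finset.exists_subset_card_eq (Nat.succ_le_of_lt hcon)
  -- Outside `far v w`, a non-neighbour `z` of `w` has at most 2m² neighbours in `G.common w u`.
  -- Removing these exceptional sets and the overlaps leaves disjoint, sparsely joined sets `X v`,
  -- whose independent transversal is too large a claw at `u`.
  set far : V → V → Finset V := fun v w =>
    {z ∈ G.nonNeighbors w | #(G.common w u \ G.common w z) ≤ 2 * m ^ 2} with hfar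
  set bad : V → Finset V := fun v =>
    (T.erase v).biUnion fun w => (G.common u v ∩ G.common u w) ∪ far v w with hbad
  set X : V → Finset V := fun v => G.common u v \ bad v with hX
  have hXc : ∀ v ∈ T, (m ^ 2 + 1) * (2 * m ^ 2) < #(X v) := by
    intro v hv
    have h1 : #(bad v) ≤ #(T.erase v) * (4 * m ^ 2) := by
      refine Finset.card_biUnion_le_card_mul _ _ _ fun w hw => ?_
      rw [Finset.mem_erase] at hw
      have e1 := (hG.inter_or_sdiff_le hF hm (hR (hT hv)) (hR (hT hw.2))).resolve_right
        (hsep v (hT hv) w (hT hw.2) hw.1.symm)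
      have e2 := hG.card_close_le hF hm (nonNeighbors_symm (hR (hT hw.2))) hc
      have e3 := Finset.card_union_le (G.common u v ∩ G.common u w) (far v w)
      simp only [hfar] at e3 ⊢
      omega
    have h2 := Finset.le_card_sdiff (bad v) (G.common u v)
    rw [hG.card_common (hR (hT hv))] at h2
    rw [Finset.card_erase_of_mem hv, hTc] at h1
    have h3 : (Nat.succ (m ^ 2) - 1) * (4 * m ^ 2) ≤ (m ^ 2 + 1) * (4 * m ^ 2) :=
      Nat.mul_le_mul_right _ (by omega)
    have h4 : (m ^ 2 + 1) * (4 * m ^ 2) + (m ^ 2 + 1) * (2 * m ^ 2) =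
      (m ^ 2 + 1) * (6 * m ^ 2) := by ring
    change _ < #(G.common u v \ bad v)
    omega
  have hXsub : ∀ v z, z ∈ X v → z ∈ G.common u v := fun v z hz => (Finset.mem_sdiff.mp hz).1
  have hXnot : ∀ v ∈ T, ∀ w ∈ T, v ≠ w → ∀ z ∈ X v, z ∉ G.common u w ∧ z ∉ far v w := by
    intro v hv w hw hvw z hz
    rw [hX, Finset.mem_sdiff, hbad, Finset.mem_biUnion] at hz
    have hwe : w ∈ T.erase v := Finset.mem_erase.mpr ⟨hvw.symm, hw⟩
    exact ⟨fun h => hz.2 ⟨w, hwe, Finset.mem_union_left _ (Finset.mem_inter.mpr ⟨hz.1, h⟩)⟩,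
      fun h => hz.2 ⟨w, hwe, Finset.mem_union_right _ h⟩⟩
  obtain ⟨Y, hYT, hYc, hYI⟩ := exists_independent_transversal (G := G) T X (2 * m ^ 2) (m ^ 2 + 1)
    hTc.le hXc
    (fun v hv w hw hvw => Finset.disjoint_left.mpr fun z hz hz' =>
      (hXnot v hv w hw hvw z hz).1 (hXsub w z hz'))
    (by
      intro v hv w hw hvw z hz
      have hzc := mem_common.mp (hXsub v z hz)
      obtain ⟨hz1, hz2⟩ := hXnot v hv w hw hvw z hz
      have hwu := mem_nonNeighbors.mp (hR (hT hw))
      have hzw : z ∈ G.nonNeighbors w := by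
        rw [mem_nonNeighbors]
        refine ⟨fun h => hwu.2 (h ▸ hzc.1), fun h => hz1 (mem_common.mpr ⟨hzc.1, h⟩)⟩
      have h1 := (hG.inter_or_sdiff_le hF hm (nonNeighbors_symm (hR (hT hw))) hzw).resolve_right
        fun h => hz2 (Finset.mem_filter.mpr ⟨hzw, h⟩)
      refine le_trans (Finset.card_le_card ?_) h1
      intro p hp
      rw [Finset.mem_filter] at hp
      have hpw := mem_common.mp (hXsub w p hp.1)
      exact Finset.mem_inter.mpr ⟨mem_common.mpr hpw.symm, mem_common.mpr ⟨hpw.2, hp.2⟩⟩)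
  have := hF.card_claw_le hm (u := u) (Y := Y) (fun y hy => by
    obtain ⟨v, -, hyv⟩ := Finset.mem_biUnion.mp (hYT hy)
    exact (mem_common.mp (hXsub v y hyv)).1) hYI
  rw [hYc, hTc] at this
  omega

theorem card_nonNeighbors_le (u : V) (hc : (2 * m ^ 2 + 1) * (2 * m ^ 2) + 2 * m ^ 2 < c)
    (hc' : (m ^ 2 + 1) * (6 * m ^ 2) < c) : #(G.nonNeighbors u) ≤ m ^ 2 * (2 * m ^ 2) := by
  refine card_le_of_separated (G.nonNeighbors u)
    (fun v w => #(G.common u v \ G.common u w) ≤ 2 * m ^ 2) (by simp) ?_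
    (fun v hv => hG.card_close_le hF hm hv hc)
    fun R hR hsep => hG.card_separated_le hF hm hR hsep hc hc'
  intro v hv w hw h
  rwa [← Finset.card_sdiff_comm (by rw [hG.card_common hv, hG.card_common hw])]

omit hF hm in
theorem degree_le_of_card_nonNeighbors_le {N : ℕ} (h : ∀ u, #(G.nonNeighbors u) ≤ N) :
    k ≤ N ^ 2 := by
  obtain ⟨u, v, huv, hadj⟩ := hG.exists_not_adj
  -- The neighbourhoods of adjacent vertices have a union of constant size, so if one adjacent pair
  -- dominates the graph then all do. For a common neighbour `z` of `u` and `v`, a non-neighbour of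
  -- `z` would then be adjacent to both, contradicting the clique condition.
  have hcov : ∀ {u z}, G.Adj u z → ∃ w, w ∈ G.nonNeighbors u ∧ w ∈ G.nonNeighbors z := by
    by_contra! hcon
    obtain ⟨u', z', hadj', hno⟩ := hcon
    have huniv : ∀ {u z}, G.Adj u z → G.neighborFinset u ∪ G.neighborFinset z = univ := by
      intro u z huz
      rw [← Finset.card_eq_iff_eq_univ, hG.srg.card_neighborFinset_union_of_adj huz,
        ← hG.srg.card_neighborFinset_union_of_adj hadj', Finset.card_eq_iff_eq_univ]
      ext w
      simp only [Finset.mem_union, mem_neighborFinset, Finset.mem_univ, iff_true]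
      by_contra! hw
      refine hno w ?_ ?_ <;> rw [mem_nonNeighbors]
      · exact ⟨fun h => hw.2 (h ▸ hadj'.symm), hw.1⟩
      · exact ⟨fun h => hw.1 (h ▸ hadj'), hw.2⟩
    obtain ⟨z, hz⟩ : (G.common u v).Nonempty := by
      rw [← Finset.card_pos, hG.card_common (mem_nonNeighbors.mpr ⟨huv.symm, hadj⟩)]
      exact hG.pos
    rw [mem_common] at hz
    obtain ⟨w, hw⟩ : (G.nonNeighbors z).Nonempty := by
      rw [Finset.nonempty_iff_ne_empty]
      intro h0
      have h1 : univ ⊆ insert z (G.neighborFinset z) := by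
        intro w _
        by_contra hcon
        simp only [Finset.mem_insert, mem_neighborFinset, not_or] at hcon
        have : w ∈ G.nonNeighbors z := mem_nonNeighbors.mpr hcon
        simp [h0] at this
      have h2 : insert u (insert v {}) ∪ G.neighborFinset u ⊆ univ := Finset.subset_univ _
      have h3 := Finset.card_le_card (h2.trans h1)
      have h4 : u ∉ insert v (G.neighborFinset u) := by simp [huv]
      have h5 : v ∉ G.neighborFinset u := by simp [hadj]
      have h6 := Finset.card_insert_le z (G.neighborFinset z)
      rw [hG.regular] at h6
      rw [Finset.insert_union, Finset.insert_union, Finset.empty_union,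
        Finset.card_insert_of_notMem h4, Finset.card_insert_of_notMem h5, hG.regular] at h3
      omega
    rw [mem_nonNeighbors] at hw
    have huw : G.Adj u w := by
      have := Finset.mem_univ w
      rw [← huniv hz.1] at this
      simpa [hw.2] using this
    have hvw : G.Adj v w := by
      have := Finset.mem_univ w
      rw [← huniv hz.2] at this
      simpa [hw.2] using this
    exact hw.2 (hG.clique huv hadj hz.1 hz.2 huw hvw hw.1.symm)
  have hsub : G.neighborFinset u ⊆ (G.nonNeighbors u).biUnion G.nonNeighbors := by
    intro z hz
    rw [mem_neighborFinset] at hz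
    obtain ⟨w, hw, hwz⟩ := hcov hz
    exact Finset.mem_biUnion.mpr ⟨w, hw, nonNeighbors_symm hwz⟩
  calc k = #(G.neighborFinset u) := (hG.regular u).symm
    _ ≤ #((G.nonNeighbors u).biUnion G.nonNeighbors) := Finset.card_le_card hsub
    _ ≤ #(G.nonNeighbors u) * N := Finset.card_biUnion_le_card_mul _ _ _ fun w _ => h w
    _ ≤ N ^ 2 := by
      rw [pow_two]
      exact Nat.mul_le_mul_right _ (h u)

end IsSRTerwilliger

end SimpleGraph

/-! ### Bounded `c`: neighbourhoods as unions of cliques. -/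

namespace SimpleGraph

open Finset

variable {V : Type*} {G : SimpleGraph V}

theorem exists_maximum_independent (G : SimpleGraph V) [DecidableRel G.Adj] (N : Finset V) :
    ∃ Y ⊆ N, (∀ y ∈ Y, ∀ z ∈ Y, ¬ G.Adj y z) ∧
      ∀ Z ⊆ N, (∀ y ∈ Z, ∀ z ∈ Z, ¬ G.Adj y z) → #Z ≤ #Y := by
  obtain ⟨Y, hY, hmax⟩ := Finset.exists_max_image
    (N.powerset.filter fun Y => ∀ y ∈ Y, ∀ z ∈ Y, ¬ G.Adj y z) Finset.card ⟨∅, by simp⟩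
  rw [Finset.mem_filter, Finset.mem_powerset] at hY
  exact ⟨Y, hY.1, hY.2, fun Z hZ hZI =>
    hmax Z (Finset.mem_filter.mpr ⟨Finset.mem_powerset.mpr hZ, hZI⟩)⟩

variable [DecidableEq V]

theorem independent_insert {Y : Finset V} {z : V} (hY : ∀ y ∈ Y, ∀ w ∈ Y, ¬ G.Adj y w)
    (hz : ∀ y ∈ Y, ¬ G.Adj y z) : ∀ y ∈ insert z Y, ∀ w ∈ insert z Y, ¬ G.Adj y w := by
  intro y hy w hw
  rcases Finset.mem_insert.mp hy with rfl | hy' <;> rcases Finset.mem_insert.mp hw with rfl | hw'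
  · exact G.loopless.irrefl _
  · exact fun h => hz w hw' h.symm
  · exact hz y hy'
  · exact hY y hy' w hw'

theorem exists_adj_of_maximum {N Y : Finset V} (hYN : Y ⊆ N)
    (hY : ∀ y ∈ Y, ∀ w ∈ Y, ¬ G.Adj y w)
    (hmax : ∀ Z ⊆ N, (∀ y ∈ Z, ∀ z ∈ Z, ¬ G.Adj y z) → #Z ≤ #Y) {z : V} (hz : z ∈ N)
    (hzY : z ∉ Y) : ∃ y ∈ Y, G.Adj y z := by
  by_contra! hcon
  have := hmax (insert z Y) (Finset.insert_subset hz hYN) (independent_insert hY hcon)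
  rw [Finset.card_insert_of_notMem hzY] at this
  omega

variable [DecidableRel G.Adj]

/-- The members of `N` that lie in the closed neighbourhood of `y` but in that of no other member
of `Y`. -/
def privatePart (G : SimpleGraph V) [DecidableRel G.Adj] (N Y : Finset V) (y : V) : Finset V :=
  {z ∈ N | z = y ∨ G.Adj y z ∧ ∀ y' ∈ Y, y' ≠ y → ¬ G.Adj y' z}

theorem mem_privatePart {N Y : Finset V} {y z : V} : z ∈ G.privatePart N Y y ↔
    z ∈ N ∧ (z = y ∨ G.Adj y z ∧ ∀ y' ∈ Y, y' ≠ y → ¬ G.Adj y' z) := by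
  simp [privatePart]

/-- Replacing `y` by two non-adjacent members of its private part would enlarge the maximum
independent set. -/
theorem privatePart_clique {N Y : Finset V} (hYN : Y ⊆ N)
    (hY : ∀ y ∈ Y, ∀ w ∈ Y, ¬ G.Adj y w)
    (hmax : ∀ Z ⊆ N, (∀ y ∈ Z, ∀ z ∈ Z, ¬ G.Adj y z) → #Z ≤ #Y) {y p q : V} (hy : y ∈ Y)
    (hp : p ∈ G.privatePart N Y y) (hq : q ∈ G.privatePart N Y y) (hpq : p ≠ q) : G.Adj p q := by
  rw [mem_privatePart] at hp hq
  obtain ⟨hpN, rfl | hp⟩ := hp <;> obtain ⟨hqN, rfl | hq⟩ := hq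
  · exact absurd rfl hpq
  · exact hq.1
  · exact hp.1.symm
  by_contra hadj
  have hE : ∀ z ∈ Y.erase y, ∀ w ∈ Y.erase y, ¬ G.Adj z w := fun z hz w hw =>
    hY z (Finset.mem_of_mem_erase hz) w (Finset.mem_of_mem_erase hw)
  have h1 : ∀ z ∈ Y.erase y, ¬ G.Adj z q := fun z hz =>
    hq.2 z (Finset.mem_of_mem_erase hz) (Finset.ne_of_mem_erase hz)
  have h2 : ∀ z ∈ insert q (Y.erase y), ¬ G.Adj z p := by
    intro z hz
    rcases Finset.mem_insert.mp hz with rfl | hz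
    · exact fun h => hadj h.symm
    · exact hp.2 z (Finset.mem_of_mem_erase hz) (Finset.ne_of_mem_erase hz)
  have hnot : ∀ {r}, G.Adj y r → r ∉ Y.erase y := fun hr hrY =>
    hY y hy _ (Finset.mem_of_mem_erase hrY) hr
  have := hmax (insert p (insert q (Y.erase y)))
    (Finset.insert_subset hpN (Finset.insert_subset hqN ((Finset.erase_subset _ _).trans hYN)))
    (independent_insert (independent_insert hE h1) h2)
  rw [Finset.card_insert_of_notMem (by
      rw [Finset.mem_insert, not_or]
      exact ⟨hpq, hnot hp.1⟩), Finset.card_insert_of_notMem (hnot hq.1),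
    Finset.card_erase_of_mem hy] at this
  have := Finset.card_pos.mpr ⟨y, hy⟩
  omega

theorem privatePart_disjoint {N Y : Finset V} (hY : ∀ y ∈ Y, ∀ w ∈ Y, ¬ G.Adj y w) {y y' : V}
    (hy : y ∈ Y) (hy' : y' ∈ Y) (hne : y ≠ y') :
    Disjoint (G.privatePart N Y y) (G.privatePart N Y y') := by
  rw [Finset.disjoint_left]
  intro w hw hw'
  rw [mem_privatePart] at hw hw'
  obtain ⟨-, rfl | hw⟩ := hw <;> obtain ⟨-, rfl | hw'⟩ := hw'
  · exact hne rfl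
  · exact hY _ hy' _ hy hw'.1
  · exact hY _ hy _ hy' hw.1
  · exact hw'.2 y hy hne hw.1

variable [Fintype V]

namespace IsSRTerwilliger

variable {k a c m : ℕ} (hG : G.IsSRTerwilliger k a c)

include hG

theorem card_common_of_adj {u v : V} (h : G.Adj u v) : #(G.common u v) = a :=
  hG.of_adj h

theorem card_common_le {u v : V} (huv : u ≠ v) (h : ¬ G.Adj u v) : #(G.common u v) ≤ c :=
  (hG.of_not_adj huv h).le

theorem degree_le_of_dominating {x : V} {Y : Finset V} (hYN : Y ⊆ G.neighborFinset x)
    (hdom : ∀ z ∈ G.neighborFinset x, z ∉ Y → ∃ y ∈ Y, G.Adj y z) : k ≤ #Y * (a + 1) := by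
  have hsub : G.neighborFinset x ⊆ Y.biUnion fun y => insert y (G.common x y) := by
    intro z hz
    rw [Finset.mem_biUnion]
    by_cases hzY : z ∈ Y
    · exact ⟨z, hzY, Finset.mem_insert_self _ _⟩
    · obtain ⟨y, hy, hyz⟩ := hdom z hz hzY
      exact ⟨y, hy, Finset.mem_insert_of_mem (mem_common.mpr ⟨by simpa using hz, hyz⟩)⟩
  rw [← hG.regular x]
  refine (Finset.card_le_card hsub).trans (Finset.card_biUnion_le_card_mul _ _ _ fun y hy => ?_)
  rw [← hG.card_common_of_adj (by simpa using hYN hy : G.Adj x y)]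
  exact Finset.card_insert_le _ _

/-- Of `y` and its `a` neighbours inside the neighbourhood of `x`, each other member of `Y` claims
at most `c`. -/
theorem card_privatePart_ge {x : V} {Y : Finset V} (hYN : Y ⊆ G.neighborFinset x)
    (hY : ∀ y ∈ Y, ∀ w ∈ Y, ¬ G.Adj y w) {y : V} (hy : y ∈ Y) :
    a + 1 ≤ #(G.privatePart (G.neighborFinset x) Y y) + #Y * c := by
  have hxy : G.Adj x y := by simpa using hYN hy
  set U := (Y.erase y).biUnion fun y' => G.common y y' with hU
  have hUc : #U ≤ #Y * c := by
    refine (Finset.card_biUnion_le_card_mul _ _ c fun y' hy' => ?_).trans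
      (Nat.mul_le_mul_right _ (Finset.card_erase_le))
    exact hG.card_common_le (Finset.ne_of_mem_erase hy').symm
      (hY y hy y' (Finset.mem_of_mem_erase hy'))
  have hsub : insert y (G.common x y \ U) ⊆ G.privatePart (G.neighborFinset x) Y y := by
    intro z hz
    rw [mem_privatePart]
    rcases Finset.mem_insert.mp hz with rfl | hz
    · exact ⟨hYN hy, Or.inl rfl⟩
    · rw [Finset.mem_sdiff, mem_common] at hz
      refine ⟨by simpa using hz.1.1, Or.inr ⟨hz.1.2, fun y' hy' hne hadj => hz.2 ?_⟩⟩
      exact Finset.mem_biUnion.mpr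
        ⟨y', Finset.mem_erase.mpr ⟨hne, hy'⟩, mem_common.mpr ⟨hz.1.2, hadj⟩⟩
  have h1 := Finset.card_le_card hsub
  rw [Finset.card_insert_of_notMem (by simp [mem_common])] at h1
  have h2 := Finset.le_card_sdiff U (G.common x y)
  rw [hG.card_common_of_adj hxy] at h2
  omega

/-- If `a` is large then the neighbourhood of a vertex is a disjoint union of large cliques. -/
theorem exists_clique_partition {x : V} {Y : Finset V} (hYN : Y ⊆ G.neighborFinset x)
    (hY : ∀ y ∈ Y, ∀ w ∈ Y, ¬ G.Adj y w)
    (hmax : ∀ Z ⊆ G.neighborFinset x, (∀ y ∈ Z, ∀ z ∈ Z, ¬ G.Adj y z) → #Z ≤ #Y)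
    (ha : #Y * #Y * c + 2 * (#Y * c) + c + 2 ≤ a) :
    ∃ Q : V → Finset V, Y.biUnion Q = G.neighborFinset x ∧
      (∀ y ∈ Y, ∀ y' ∈ Y, y ≠ y' → Disjoint (Q y) (Q y')) ∧
      (∀ y ∈ Y, ∀ p ∈ Q y, ∀ q ∈ Q y, p ≠ q → G.Adj p q) ∧
      ∀ y ∈ Y, a + 1 ≤ #(Q y) + #Y * c := by
  set N := G.neighborFinset x with hN
  set P := G.privatePart N Y with hP
  have hPc : ∀ y ∈ Y, a + 1 ≤ #(P y) + #Y * c := fun y hy => hG.card_privatePart_ge hYN hY hy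
  have hPclique : ∀ y ∈ Y, ∀ p ∈ P y, ∀ q ∈ P y, p ≠ q → G.Adj p q := fun y hy p hp q hq =>
    privatePart_clique hYN hY hmax hy hp hq
  have hPN : ∀ {y z}, z ∈ P y → z ∈ N := fun h => (mem_privatePart.mp h).1
  -- The private parts miss only vertices with two neighbours in `Y`, all of which lie in the set
  -- `R` below; `Q y` enlarges `P y` to absorb them.
  set Q : V → Finset V := fun y => {z ∈ N | ∀ p ∈ P y, p ≠ z → G.Adj p z} with hQ
  have hPQ : ∀ y ∈ Y, P y ⊆ Q y := fun y hy z hz =>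
    Finset.mem_filter.mpr ⟨hPN hz, fun p hp hpz => hPclique y hy p hp z hz hpz⟩
  set R := Y.offDiag.biUnion fun e => G.common e.1 e.2 with hR
  have hRc : #R ≤ #Y * #Y * c := by
    refine (Finset.card_biUnion_le_card_mul _ _ c fun e he => ?_).trans
      (Nat.mul_le_mul_right _ (by rw [Finset.offDiag_card]; omega))
    rw [Finset.mem_offDiag] at he
    exact hG.card_common_le he.2.2 (hY _ he.1 _ he.2.1)
  have hcov : N ⊆ R ∪ Y.biUnion P := by
    intro z hz
    rw [Finset.mem_union, or_iff_not_imp_left]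
    intro hzR
    rw [Finset.mem_biUnion]
    by_cases hzY : z ∈ Y
    · exact ⟨z, hzY, mem_privatePart.mpr ⟨hz, Or.inl rfl⟩⟩
    obtain ⟨y, hy, hyz⟩ := exists_adj_of_maximum hYN hY hmax hz hzY
    refine ⟨y, hy, mem_privatePart.mpr ⟨hz, Or.inr ⟨hyz, fun y' hy' hne hadj => hzR ?_⟩⟩⟩
    exact Finset.mem_biUnion.mpr
      ⟨(y, y'), Finset.mem_offDiag.mpr ⟨hy, hy', hne.symm⟩, mem_common.mpr ⟨hyz, hadj⟩⟩
  refine ⟨Q, ?_, ?_, ?_, fun y hy => (hPc y hy).trans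
    (Nat.add_le_add_right (Finset.card_le_card (hPQ y hy)) _)⟩
  · refine Finset.Subset.antisymm
      (Finset.biUnion_subset.mpr fun y _ => Finset.filter_subset _ _) fun z hz => ?_
    have hxz : G.Adj x z := by simpa [hN] using hz
    -- Since `a` exceeds |R| + |Y|c, some private part holds more than `c` neighbours of `z`. Then
    -- `z` is adjacent to all the rest of it, as non-adjacent vertices share only `c` neighbours.
    obtain ⟨y, hy, hyc⟩ : ∃ y ∈ Y, c < #{p ∈ P y | G.Adj z p} := by
      by_contra! hcon
      have hsub : G.common x z ⊆ R ∪ Y.biUnion fun y => {p ∈ P y | G.Adj z p} := by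
        intro p hp
        rw [mem_common] at hp
        have := hcov (by simpa [hN] using hp.1 : p ∈ N)
        rw [Finset.mem_union] at this ⊢
        refine this.imp id fun h => ?_
        obtain ⟨y, hy, hpy⟩ := Finset.mem_biUnion.mp h
        exact Finset.mem_biUnion.mpr ⟨y, hy, Finset.mem_filter.mpr ⟨hpy, hp.2⟩⟩
      have h1 := Finset.card_le_card hsub
      have h2 := Finset.card_union_le R (Y.biUnion fun y => {p ∈ P y | G.Adj z p})
      have h3 := Finset.card_biUnion_le_card_mul Y (fun y => {p ∈ P y | G.Adj z p}) c hcon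
      rw [hG.card_common_of_adj hxz] at h1
      omega
    refine Finset.mem_biUnion.mpr ⟨y, hy, Finset.mem_filter.mpr ⟨hz, fun p hp hpz => ?_⟩⟩
    by_contra hadj
    have hsub : ({p ∈ P y | G.Adj z p} : Finset V) ⊆ G.common p z := by
      intro q hq
      rw [Finset.mem_filter] at hq
      refine mem_common.mpr ⟨hPclique y hy p hp q hq.1 ?_, hq.2⟩
      rintro rfl
      exact hadj hq.2.symm
    have := (Finset.card_le_card hsub).trans (hG.card_common_le hpz hadj)
    omega
  · intro y hy y' hy' hne
    rw [Finset.disjoint_left]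
    intro z hz hz'
    rw [hQ, Finset.mem_filter] at hz hz'
    have hsub : (P y ∪ P y').erase z ⊆ G.common x z := by
      intro p hp
      rw [Finset.mem_erase, Finset.mem_union] at hp
      rw [mem_common]
      rcases hp.2 with h | h
      · exact ⟨by simpa [hN] using hPN h, (hz.2 p h hp.1).symm⟩
      · exact ⟨by simpa [hN] using hPN h, (hz'.2 p h hp.1).symm⟩
    have h1 := Finset.card_le_card hsub
    rw [hG.card_common_of_adj (by simpa [hN] using hz.1)] at h1
    have h2 := Finset.pred_card_le_card_erase (a := z) (s := P y ∪ P y')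
    have hd : Disjoint (P y) (P y') := privatePart_disjoint hY hy hy' hne
    rw [Finset.card_union_of_disjoint hd] at h2
    have h3 := hPc y hy
    have h4 := hPc y' hy'
    have h5 : 0 ≤ #Y * #Y * c := Nat.zero_le _
    omega
  · intro y hy z hz z' hz' hne
    rw [hQ, Finset.mem_filter] at hz hz'
    by_contra hadj
    have hsub : ((P y).erase z).erase z' ⊆ G.common z z' := by
      intro p hp
      rw [Finset.mem_erase, Finset.mem_erase] at hp
      exact mem_common.mpr ⟨(hz.2 p hp.2.2 hp.2.1).symm, (hz'.2 p hp.2.2 hp.1).symm⟩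
    have h1 := (Finset.card_le_card hsub).trans (hG.card_common_le hne hadj)
    have h2 := Finset.pred_card_le_card_erase (a := z) (s := P y)
    have h3 := Finset.pred_card_le_card_erase (a := z') (s := (P y).erase z)
    have h4 := hPc y hy
    omega

theorem card_nonadjacent_pairs (x : V) :
    #{e ∈ G.neighborFinset x ×ˢ G.neighborFinset x | e.1 ≠ e.2 ∧ ¬ G.Adj e.1 e.2} +
      k * (a + 1) = k * k := by
  set N := G.neighborFinset x with hN
  have h1 : #{e ∈ N ×ˢ N | e.1 ≠ e.2 ∧ ¬ G.Adj e.1 e.2} =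
      ∑ z ∈ N, #{w ∈ N | z ≠ w ∧ ¬ G.Adj z w} := by
    simp only [Finset.card_filter]
    rw [Finset.sum_product]
  have h2 : ∀ z ∈ N, #{w ∈ N | z ≠ w ∧ ¬ G.Adj z w} + (a + 1) = k := by
    intro z hz
    have hxz : G.Adj x z := by simpa [hN] using hz
    have e1 : ({w ∈ N | z ≠ w ∧ ¬ G.Adj z w} : Finset V) = N \ insert z (G.common x z) := by
      ext w
      simp only [Finset.mem_filter, Finset.mem_sdiff, Finset.mem_insert, mem_common, not_or,
        hN, mem_neighborFinset]
      grind
    have e2 : insert z (G.common x z) ⊆ N := by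
      refine Finset.insert_subset hz fun w hw => ?_
      simpa [hN] using (mem_common.mp hw).1
    have e3 := Finset.card_sdiff_add_card_eq_card e2
    rw [Finset.card_insert_of_notMem (by simp [mem_common]), hG.card_common_of_adj hxz,
      hG.regular x] at e3
    rw [e1]
    exact e3
  have h3 : ∑ z ∈ N, (#{w ∈ N | z ≠ w ∧ ¬ G.Adj z w} + (a + 1)) = ∑ z ∈ N, k :=
    Finset.sum_congr rfl h2
  rw [Finset.sum_add_distrib, Finset.sum_const, Finset.sum_const, smul_eq_mul, smul_eq_mul,
    hG.regular x] at h3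
  rw [h1, h3]

theorem card_nonadjacent_pairs_mul_le {x : V} {Y : Finset V} {Q : V → Finset V}
    (hQN : Y.biUnion Q = G.neighborFinset x)
    (hQd : ∀ y ∈ Y, ∀ y' ∈ Y, y ≠ y' → Disjoint (Q y) (Q y'))
    (hQc : ∀ y ∈ Y, ∀ p ∈ Q y, ∀ q ∈ Q y, p ≠ q → G.Adj p q)
    {b : V → ℕ} (hb : ∀ y ∈ Y, #(Q y) + b y = a + 1) :
    #{e ∈ G.neighborFinset x ×ˢ G.neighborFinset x | e.1 ≠ e.2 ∧ ¬ G.Adj e.1 e.2} * (c - 1) ≤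
      2 * a * (a + 1) * ∑ y ∈ Y, b y := by
  set N := G.neighborFinset x with hN
  set D : Finset (V × V) := {e ∈ N ×ˢ N | e.1 ≠ e.2 ∧ ¬ G.Adj e.1 e.2} with hD
  have hmemN : ∀ {z}, z ∈ N ↔ G.Adj x z := by simp [hN]
  -- The common neighbours of a non-adjacent pair form a clique containing `x`, so all but `x`
  -- itself lie in `N`.
  have h1 : ∑ e ∈ D, #{q ∈ N | G.Adj q e.1 ∧ G.Adj q e.2} = #D * (c - 1) := by
    rw [Finset.sum_const_nat]
    intro e he
    rw [hD, Finset.mem_filter, Finset.mem_product, hmemN, hmemN] at he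
    have hx : x ∈ G.common e.1 e.2 := mem_common.mpr ⟨he.1.1.symm, he.1.2.symm⟩
    have hc : #(G.common e.1 e.2) = c := hG.of_not_adj he.2.1 he.2.2
    rw [← hc, ← Finset.card_erase_of_mem hx]
    congr 1
    ext q
    rw [Finset.mem_filter, Finset.mem_erase, mem_common, hmemN]
    constructor
    · rintro ⟨hq, hq1, hq2⟩
      exact ⟨hq.ne', hq1.symm, hq2.symm⟩
    · rintro ⟨hq, hq1, hq2⟩
      exact ⟨hG.clique he.2.1 he.2.2 he.1.1.symm he.1.2.symm hq1 hq2 hq.symm, hq1.symm, hq2.symm⟩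
  have h2 : ∑ e ∈ D, #{q ∈ N | G.Adj q e.1 ∧ G.Adj q e.2} =
      ∑ q ∈ N, #{e ∈ D | G.Adj q e.1 ∧ G.Adj q e.2} :=
    (Finset.sum_card_bipartiteAbove_eq_sum_card_bipartiteBelow
      (s := N) (t := D) fun (q : V) (e : V × V) => G.Adj q e.1 ∧ G.Adj q e.2).symm
  have h3 : ∀ y ∈ Y, ∀ q ∈ Q y, #{e ∈ D | G.Adj q e.1 ∧ G.Adj q e.2} ≤ 2 * a * b y := by
    intro y hy q hq
    have hqN : ∀ {p}, p ∈ Q y → G.Adj x p := fun {p} hp =>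
      hmemN.mp (hQN ▸ Finset.mem_biUnion.mpr ⟨y, hy, hp⟩)
    set C := G.common x q with hC
    set E := (Q y).erase q with hE
    have hEC : E ⊆ C := by
      intro p hp
      rw [hE, Finset.mem_erase] at hp
      exact mem_common.mpr ⟨hqN hp.2, hQc y hy q hq p hp.2 hp.1.symm⟩
    -- A non-adjacent pair cannot lie inside the clique `Q y`, which leaves at most a² - (a - b y)²
    -- ≤ 2a · b y pairs.
    have hsub : ({e ∈ D | G.Adj q e.1 ∧ G.Adj q e.2} : Finset (V × V)) ⊆ C ×ˢ C \ E ×ˢ E := by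
      intro e he
      rw [Finset.mem_filter, hD, Finset.mem_filter, Finset.mem_product, hmemN, hmemN] at he
      rw [Finset.mem_sdiff, Finset.mem_product, Finset.mem_product, mem_common, mem_common]
      refine ⟨⟨⟨he.1.1.1, he.2.1⟩, he.1.1.2, he.2.2⟩, fun h => he.1.2.2 ?_⟩
      exact hQc y hy _ (Finset.mem_of_mem_erase h.1) _ (Finset.mem_of_mem_erase h.2) he.1.2.1
    have e1 := Finset.card_le_card hsub
    have e2 := Finset.card_sdiff_add_card_eq_card (Finset.product_subset_product hEC hEC)
    rw [Finset.card_product, Finset.card_product, hC, hG.card_common_of_adj (hqN hq)] at e2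
    have e3 : #E + 1 = #(Q y) := Finset.card_erase_add_one hq
    have e4 : a = #E + b y := by
      have := hb y hy
      omega
    have e5 : a * a ≤ #E * #E + 2 * a * b y := by
      rw [e4]
      nlinarith [Nat.zero_le (b y * b y)]
    rw [hC] at e1
    omega
  rw [← h1, h2, ← hQN, Finset.sum_biUnion (fun y hy y' hy' h => hQd y hy y' hy' h), Finset.mul_sum]
  refine Finset.sum_le_sum fun y hy => ?_
  calc _ ≤ #(Q y) • (2 * a * b y) := Finset.sum_le_card_nsmul _ _ _ (h3 y hy)
    _ ≤ (a + 1) * (2 * a * b y) := by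
      rw [smul_eq_mul]
      exact Nat.mul_le_mul_right _ (by have := hb y hy; omega)
    _ = _ := by ring

end IsSRTerwilliger

end SimpleGraph

/-! ### Arithmetic of the parameters and the degree bound. -/

namespace SimpleGraph

open Finset

/-- The hypotheses place d² strictly between (e - 1)² and (e + 1)². -/
theorem eq_of_sq_sub_sq_lt {d e : ℤ} (hd : 0 ≤ d) (h1 : d * d - e * e < 2 * e + 1)
    (h2 : e * e - d * d < 2 * e - 1) : d = e := by
  have he : 0 ≤ e := by
    by_contra! h
    linarith
  rcases lt_trichotomy d e with h | h | h
  · have : d * d ≤ (e - 1) * (e - 1) := mul_self_le_mul_self hd (by omega)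
    linarith
  · exact h
  · have : (e + 1) * (e + 1) ≤ d * d := mul_self_le_mul_self (by omega) (by omega)
    linarith

/-- A bound for the solutions of the constraints on the parameters of a strongly regular Terwilliger
graph whose local graphs are unions of `s` cliques. -/
theorem parameter_bound_int {a c s B d : ℤ} (hc : 1 ≤ c) (hs : 2 ≤ s) (hB0 : 0 ≤ B)
    (hBs : B ≤ s * s * c) (hd0 : 0 ≤ d)
    (hd : (a - c) ^ 2 + 4 * (s * (a + 1) - B - c) = d * d)
    (hcount : (s * (a + 1) - B) * (s * (a + 1) - B) * (c - 1) ≤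
      2 * a * (a + 1) * B + (s * (a + 1) - B) * (a + 1) * (c - 1)) :
    a < 20 * (s * s * c * c) := by
  by_contra! hbig
  have g0 : c ≤ s * c := le_mul_of_one_le_left (by linarith) (by linarith)
  have g1 : s * s ≤ s * s * c := le_mul_of_one_le_right (by positivity) hc
  have g2 : s * c ≤ s * s * c :=
    mul_le_mul_of_nonneg_right (le_mul_of_one_le_left (by linarith) (by linarith)) (by linarith)
  have g3 : s ≤ s * s := le_mul_of_one_le_left (by linarith) (by linarith)
  have g4 : s * s * c ≤ s * s * c * c := le_mul_of_one_le_right (by positivity) hc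
  -- The right side is free of `a`, so for large `a` it must vanish, which determines `B`.
  have hw : d * d - (a - c + 2 * s) * (a - c + 2 * s) = 4 * (s + s * c - B - c - s * s) := by
    rw [← hd]
    ring
  have hde : d = a - c + 2 * s := eq_of_sq_sub_sq_lt hd0 (by linarith) (by linarith)
  have hB : B = (s - 1) * (c - s) := by
    rw [hde] at hw
    linarith
  have hBsc : B ≤ s * c := by
    have : B = s * c - c - s * s + s := by rw [hB]; ring
    linarith
  have h1 : (a + 1) * ((a + 1) * (s * (s - 1) * (c - 1) - 2 * B)) ≤
      (a + 1) * ((2 * s - 1) * B * (c - 1)) := by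
    have e3 : 0 ≤ B * B * (c - 1) := mul_nonneg (mul_nonneg hB0 hB0) (by linarith)
    have e4 : 0 ≤ 2 * (a + 1) * B :=
      mul_nonneg (by linarith [(by positivity : 0 ≤ s * s * c * c)]) hB0
    linarith
  have ha : 0 < a + 1 := by linarith [(by positivity : 0 ≤ s * s * c * c)]
  have h2 := le_of_mul_le_mul_left h1 ha
  -- This is the leading coefficient in `a + 1` of the counting inequality; its positivity bounds
  -- `a`.
  have h3 : 1 ≤ s * (s - 1) * (c - 1) - 2 * B := by
    have e1 : s * (s - 1) * (c - 1) - 2 * B = (s - 1) * ((s - 2) * c + s) := by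
      rw [hB]
      ring
    have e2 : 0 ≤ (s - 2) * c := mul_nonneg (by linarith) (by linarith)
    have e3 : 1 * 1 ≤ (s - 1) * ((s - 2) * c + s) :=
      mul_le_mul (by linarith) (by linarith) zero_le_one (by linarith)
    linarith
  have h4 : a + 1 ≤ (2 * s - 1) * B * (c - 1) :=
    (le_mul_of_one_le_right ha.le h3).trans h2
  have h5 : (2 * s - 1) * B * (c - 1) ≤ 2 * s * (s * c) * c := by
    have : 0 ≤ 2 * s - 1 := by linarith
    gcongr <;> linarith
  have h6 : 2 * s * (s * c) * c = 2 * (s * s * c * c) := by ring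
  linarith [(by positivity : 0 ≤ s * s * c * c)]

theorem parameter_bound {k a c s B : ℕ} (hc : 1 ≤ c) (hkB : k + B = s * (a + 1))
    (hBs : B ≤ s * s * c) (hak : a + 2 ≤ k) (hca : c ≤ a)
    (hsq : IsSquare ((a - c) ^ 2 + 4 * (k - c)))
    (hcount : k * k * (c - 1) ≤ 2 * a * (a + 1) * B + k * (a + 1) * (c - 1)) :
    a < 20 * (s * s * c * c) := by
  have hs : 2 ≤ s := by
    by_contra! h
    have : s * (a + 1) ≤ 1 * (a + 1) := Nat.mul_le_mul_right _ (by omega)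
    omega
  obtain ⟨d, hd⟩ := hsq
  have hk : (k : ℤ) = s * (a + 1) - B := by
    have := congrArg (Nat.cast (R := ℤ)) hkB
    push_cast at this
    linarith
  have hd' := congrArg (Nat.cast (R := ℤ)) hd
  have hcount' : ((k * k * (c - 1) : ℕ) : ℤ) ≤
    ((2 * a * (a + 1) * B + k * (a + 1) * (c - 1) : ℕ) : ℤ) := by exact_mod_cast hcount
  push_cast [hca, show c ≤ k by omega, hc, hk] at hd' hcount'
  exact_mod_cast parameter_bound_int (a := a) (c := c) (s := s) (B := B) (d := d)
    (by exact_mod_cast hc) (by exact_mod_cast hs) (by positivity) (by exact_mod_cast hBs)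
    (by positivity) hd' hcount'

variable {V : Type*} [Fintype V] [DecidableEq V] {G : SimpleGraph V} [DecidableRel G.Adj]

namespace IsSRTerwilliger

variable {k a c m : ℕ} (hG : G.IsSRTerwilliger k a c) (hF : G.FormBound m) (hm : 0 < m)

include hG

theorem parameter_inequalities : a + 2 ≤ k ∧ c ≤ a + 1 ∧ k + 1 ≤ Fintype.card V := by
  obtain ⟨u, v, huv, hadj⟩ := hG.exists_not_adj
  obtain ⟨z, hz⟩ : (G.common u v).Nonempty := by
    rw [← Finset.card_pos, hG.card_common (mem_nonNeighbors.mpr ⟨huv.symm, hadj⟩)]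
    exact hG.pos
  have hz' := mem_common.mp hz
  refine ⟨?_, ?_, ?_⟩
  · have hsub : insert u (insert v (G.common u z)) ⊆ G.neighborFinset z := by
      intro w hw
      rw [mem_neighborFinset]
      rcases Finset.mem_insert.mp hw with rfl | hw
      · exact hz'.1.symm
      rcases Finset.mem_insert.mp hw with rfl | hw
      · exact hz'.2.symm
      · exact (mem_common.mp hw).2
    have := Finset.card_le_card hsub
    rw [Finset.card_insert_of_notMem (by simp [mem_common, huv]),
      Finset.card_insert_of_notMem (by simp [mem_common, hadj]), hG.regular,
      hG.card_common_of_adj hz'.1] at this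
    exact this
  · have hsub : (G.common u v).erase z ⊆ G.common u z := by
      intro w hw
      rw [Finset.mem_erase] at hw
      have hw' := mem_common.mp hw.2
      exact mem_common.mpr ⟨hw'.1, (hG.clique huv hadj hw'.1 hw'.2 hz'.1 hz'.2 hw.1).symm⟩
    have := Finset.card_le_card hsub
    rw [Finset.card_erase_of_mem hz, hG.card_common_of_adj hz'.1,
      hG.card_common (mem_nonNeighbors.mpr ⟨huv.symm, hadj⟩)] at this
    omega
  · have : insert u (G.neighborFinset u) ⊆ univ := Finset.subset_univ _
    have := Finset.card_le_card this
    rwa [Finset.card_insert_of_notMem (by simp), hG.regular, Finset.card_univ] at this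

/-- As `c ≥ 1`, every vertex is within distance two of `u`. -/
theorem card_le : Fintype.card V ≤ 1 + k + k * k := by
  obtain ⟨u, -⟩ := hG.exists_not_adj
  have hsub : (univ : Finset V) ⊆
      insert u (G.neighborFinset u) ∪ (G.neighborFinset u).biUnion fun z => G.neighborFinset z := by
    intro v _
    rw [Finset.mem_union, or_iff_not_imp_left]
    intro hv
    rw [Finset.mem_insert, mem_neighborFinset, not_or] at hv
    obtain ⟨z, hz⟩ : (G.common u v).Nonempty := by
      rw [← Finset.card_pos, hG.card_common (mem_nonNeighbors.mpr hv)]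
      exact hG.pos
    rw [mem_common] at hz
    exact Finset.mem_biUnion.mpr ⟨z, by simpa using hz.1, by simpa using hz.2.symm⟩
  have h1 := Finset.card_le_card hsub
  have h2 := Finset.card_union_le (insert u (G.neighborFinset u))
    ((G.neighborFinset u).biUnion fun z => G.neighborFinset z)
  have h3 := Finset.card_insert_le u (G.neighborFinset u)
  have h4 := Finset.card_biUnion_le_card_mul (G.neighborFinset u) (fun z => G.neighborFinset z) k
    fun z _ => (hG.regular z).le
  rw [hG.regular] at h3 h4
  rw [Finset.card_univ] at h1
  omega

include hF hm

theorem degree_le_of_c_le {F : ℕ} (hc : c ≤ F) :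
    k ≤ m ^ 2 * (20 * (m ^ 2 * m ^ 2 * F * F) + F + 1) := by
  obtain ⟨hak, hca, hkn⟩ := hG.parameter_inequalities
  have hc1 := hG.pos
  obtain ⟨x, -⟩ := hG.exists_not_adj
  obtain ⟨Y, hYN, hY, hmax⟩ := exists_maximum_independent G (G.neighborFinset x)
  have hs : #Y ≤ m ^ 2 := hF.card_claw_le hm (fun y hy => by simpa using hYN hy) hY
  have hk : k ≤ #Y * (a + 1) := hG.degree_le_of_dominating hYN fun z hz hzY =>
    exists_adj_of_maximum hYN hY hmax hz hzY
  refine hk.trans (Nat.mul_le_mul hs (Nat.succ_le_succ ?_))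
  have hmono : #Y * #Y * c * c ≤ m ^ 2 * m ^ 2 * F * F := by gcongr
  -- The summand `c` secures `c ≤ a`, needed for the perfect square; the main term also clears the
  -- threshold of the clique partition.
  suffices h : a ≤ 20 * (#Y * #Y * c * c) + c by omega
  by_contra! hbig
  have hs1 : 1 ≤ #Y := by
    by_contra! h
    have h0 : #Y = 0 := by omega
    rw [h0] at hk
    omega
  have hb1 : #Y * #Y * c ≤ #Y * #Y * c * c := Nat.le_mul_of_pos_right _ hc1
  have hb2 : #Y * c ≤ #Y * #Y * c := Nat.mul_le_mul_right _ (Nat.le_mul_of_pos_right _ hs1)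
  have hb3 : c ≤ #Y * c := Nat.le_mul_of_pos_left _ hs1
  obtain ⟨Q, hQN, hQd, hQc, hQa⟩ := hG.exists_clique_partition hYN hY hmax (by omega)
  have hQle : ∀ y ∈ Y, #(Q y) ≤ a + 1 := by
    intro y hy
    rcases (Q y).eq_empty_or_nonempty with h | ⟨q, hq⟩
    · simp [h]
    have hQx : ∀ {p}, p ∈ Q y → G.Adj x p := fun {p} hp => by
      have : p ∈ G.neighborFinset x := hQN ▸ Finset.mem_biUnion.mpr ⟨y, hy, hp⟩
      simpa using this
    have hsub : (Q y).erase q ⊆ G.common x q := by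
      intro p hp
      rw [Finset.mem_erase] at hp
      exact mem_common.mpr ⟨hQx hp.2, hQc y hy q hq p hp.2 hp.1.symm⟩
    have := Finset.card_le_card hsub
    rw [Finset.card_erase_of_mem hq, hG.card_common_of_adj (hQx hq)] at this
    omega
  have hb : ∀ y ∈ Y, #(Q y) + (a + 1 - #(Q y)) = a + 1 := fun y hy =>
    Nat.add_sub_cancel' (hQle y hy)
  have hcount := hG.card_nonadjacent_pairs_mul_le hQN hQd hQc hb
  have hpairs := hG.card_nonadjacent_pairs x
  set B := ∑ y ∈ Y, (a + 1 - #(Q y)) with hBdef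
  have hkB : k + B = #Y * (a + 1) := by
    rw [← hG.regular x, ← hQN, Finset.card_biUnion hQd, hBdef, ← Finset.sum_add_distrib,
      Finset.sum_congr rfl hb, Finset.sum_const, smul_eq_mul]
  have hBs : B ≤ #Y * #Y * c := by
    rw [mul_assoc, ← smul_eq_mul (#Y)]
    refine Finset.sum_le_card_nsmul _ _ _ fun y hy => ?_
    have := hQa y hy
    omega
  have hsq := hG.srg.isSquare_discriminant (by omega) (by omega) (by omega) (by omega) hkn
    (by omega)
  have := parameter_bound hc1 hkB hBs hak (by omega) hsq (by
    rw [← hpairs, add_mul]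
    exact Nat.add_le_add_right hcount _)
  omega

theorem exists_degree_bound : k ≤ (m ^ 2 * (2 * m ^ 2)) ^ 2 +
    m ^ 2 * (20 * (m ^ 2 * m ^ 2 * (20 * (m ^ 2 + 1) ^ 2) * (20 * (m ^ 2 + 1) ^ 2)) +
      20 * (m ^ 2 + 1) ^ 2 + 1) := by
  -- The threshold dominates both lower bounds on `c` required by `card_nonNeighbors_le`.
  rcases le_or_gt c (20 * (m ^ 2 + 1) ^ 2) with hc | hc
  · exact (hG.degree_le_of_c_le hF hm hc).trans (Nat.le_add_left _ _)
  · refine (hG.degree_le_of_card_nonNeighbors_le fun u =>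
      hG.card_nonNeighbors_le hF hm u ?_ ?_).trans (Nat.le_add_right _ _)
    · refine lt_of_le_of_lt ?_ hc
      nlinarith [sq_nonneg (m ^ 2)]
    · refine lt_of_le_of_lt ?_ hc
      nlinarith [sq_nonneg (m ^ 2)]

end IsSRTerwilliger

end SimpleGraph

/-- Finitely many up to isomorphism: a finite list of graphs contains an isomorphic copy of each
graph with the stated properties. -/
theorem lemma7 (m : ℤ) (hm : 2 ≤ m) :
    ∃ S : Finset (Σ n : ℕ, SimpleGraph (Fin n)),
      ∀ (V : Type*) [Fintype V] [DecidableEq V] (G : SimpleGraph V) [DecidableRel G.Adj] (θ : ℝ),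
        G ≠ ⊤ → G.IsStronglyRegular → G.IsTerwilliger →
        G.IsSmallestEigenvalue θ → -(m : ℝ) ≤ θ →
          ∃ H ∈ S, Nonempty (G ≃g H.2) := by
  classical
  lift m to ℕ using by omega
  set K := (m ^ 2 * (2 * m ^ 2)) ^ 2 +
    m ^ 2 * (20 * (m ^ 2 * m ^ 2 * (20 * (m ^ 2 + 1) ^ 2) * (20 * (m ^ 2 + 1) ^ 2)) +
      20 * (m ^ 2 + 1) ^ 2 + 1) with hK
  refine ⟨(Finset.range (1 + K + K * K + 1)).sigma fun _ => Finset.univ, ?_⟩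
  intro V _ _ G _ θ _ hsr hT hθ hmθ
  obtain ⟨n, k, a, c, hsrg⟩ := hsr
  have hG := hT.isSRTerwilliger hsrg
  have hk : k ≤ K := hG.exists_degree_bound (hθ.formBound (by exact_mod_cast hmθ)) (by omega)
  have hcard : Fintype.card V ≤ 1 + K + K * K := hG.card_le.trans (by gcongr)
  refine ⟨⟨Fintype.card V, G.map (Fintype.equivFin V).toEmbedding⟩, ?_,
    ⟨SimpleGraph.Iso.map (Fintype.equivFin V) G⟩⟩
  rw [Finset.mem_sigma]
  exact ⟨Finset.mem_range.mpr (Nat.lt_succ_of_le hcard), Finset.mem_univ _⟩
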